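/- Let $n,d\in\mathbb N$ be positive integers, let $\mu\in(0,n]$ and $q\in(0,d]$ be real numbers, and let $f:\mathbb R^n\to\mathbb R^d$ be continuous (both spaces carry the Euclidean metric). For an arbitrary set $E\subset\mathbb R^n$ put $$\Phi(E)=\inf\sum_{\alpha\in\mathbb N}\bigl(\operatorname{diam} D_\alpha\bigr)^{\mu}\,\bigl(\operatorname{diam} f(D_\alpha)\bigr)^{q}\in[0,\infty],$$ where the infimum is taken over all countable families $\{D_\alpha\}_{\alpha\in\mathbb N}$ of compact (possibly empty, with $\operatorname{diam}\emptyset=0$) subsets of $\mathbb R^n$ such that $E\subset\bigcup_\alpha D_\alpha$. Then $\Phi$ is countably subadditive: whenever $E\subset\bigcup_{i\in I}E_i$ for a countable family $(E_i)_{i\in I}$ of subsets of $\mathbb R^n$, one has $\Phi(E)\le\sum_{i\in I}\Phi(E_i)$. Moreover, for every set $E\subset\mathbb R^n$ with $\Phi(E)=0$, $$\mathcal H^{\mu}\bigl(E\cap f^{-1}(y)\bigr)=0\qquad\text{for }\mathcal H^{q}\text{-almost every }y\in\mathbb R^d,$$ where $\mathcal H^s$ denotes the $s$-dimensional Hausdorff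 (outer) measure. -/

import Mathlib

open MeasureTheory Set
open scoped ENNReal

/-- `coverPhi μ q f E` is the infimum of `∑ α, (diam D α) ^ μ * (diam f(D α)) ^ q` over all
countable families `D : ℕ → Set ℝⁿ` of compact sets with `E ⊆ ⋃ α, D α`. It takes values in
`[0, ∞]`; compact sets may be empty, so finite covers are included. -/
noncomputable def coverPhi {n d : ℕ} (μ q : ℝ)
    (f : EuclideanSpace ℝ (Fin n) → EuclideanSpace ℝ (Fin d))
    (E : Set (EuclideanSpace ℝ (Fin n))) : ℝ≥0∞ :=
  ⨅ (D : ℕ → Set (EuclideanSpace ℝ (Fin n)))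
    (_ : ∀ α, IsCompact (D α)) (_ : E ⊆ ⋃ α, D α),
    ∑' α, Metric.ediam (D α) ^ μ * Metric.ediam (f '' D α) ^ q

/-! Subadditivity is concatenation of nearly optimal covers. For the null statement, a cover `D`
with small sum gives `g(y) = ∑ (diam D α)^μ`, over the `α` with `y ∈ f(D α)`, which bounds the
`μ`-content of `E ∩ f⁻¹(y)`. It must be shown that `g` is small off a set of small `q`-content.
Content is only subadditive, so integrating `g` is not available. The substitute is the Chebyshev
bound `exists_cover_superlevel`: the content of `{g > t}` is at most `C/t` times the covering sum.
The sets `f(D α)` are replaced by dyadic cubes, and `exists_tree_selection` walks down the dyadic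
forest with a residual threshold, selecting a cube once its cost is paid for by the weighted cost
below it. Zero content then forces zero Hausdorff measure, both for the exceptional `y` and for the
fibres. -/

open Filter Topology

/-! ### Selection in weighted forests -/

/-- The residual threshold at the node `k` of level `j`: the initial threshold minus the weights of
all strict ancestors of the node. -/
noncomputable def residualThreshold {κ : Type*} (p : κ → κ) (m : ℕ → κ → ℝ≥0∞) (t : ℝ≥0∞) :
    ℕ → κ → ℝ≥0∞
  | 0, _ => t
  | j + 1, k => residualThreshold p m t j (p k) - m j (p k)

/-- A node is active if none of its strict ancestors `Q` satisfies the stopping condition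
`R(Q) * L(Q) ≤ W(Q)`. -/
def IsActiveNode {κ : Type*} (p : κ → κ) (L : ℕ → ℝ≥0∞) (W R : ℕ → κ → ℝ≥0∞) : ℕ → κ → Prop
  | 0, _ => True
  | j + 1, k => IsActiveNode p L W R j (p k) ∧ W j (p k) < R j (p k) * L j

theorem residualThreshold_le {κ : Type*} (p : κ → κ) (m : ℕ → κ → ℝ≥0∞) (t : ℝ≥0∞) (j : ℕ) (k : κ) :
    residualThreshold p m t j k ≤ t := by
  induction j generalizing k with
  | zero => exact le_rfl
  | succ j ih => exact tsub_le_self.trans (ih _)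

theorem residualThreshold_branch {κ : Type*} (p : κ → κ) (m : ℕ → κ → ℝ≥0∞) (t : ℝ≥0∞)
    (a : ℕ → κ) (ha : ∀ j, p (a (j + 1)) = a j) (j : ℕ) :
    residualThreshold p m t j (a j) = t - ∑ i ∈ Finset.range j, m i (a i) := by
  induction j with
  | zero => simp [residualThreshold]
  | succ j ih => rw [residualThreshold, ha, ih, Finset.sum_range_succ, tsub_tsub]

theorem ENNReal.div_tsub_le_div {A L W m r : ℝ≥0∞} (hL0 : L ≠ 0) (hL : L ≠ ∞) (hr : r ≠ ∞)
    (hW : m * L + A ≤ W) (hWr : W < r * L) : A / (r - m) ≤ W / r := by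
  have hWt : W ≠ ∞ := (hWr.trans_le le_top).ne
  have hAt : A ≠ ∞ := ne_top_of_le_ne_top hWt (le_add_self.trans hW)
  have hmr : m < r := by
    by_contra! h
    exact absurd (hWr.trans_le ((mul_le_mul_left h L).trans (le_self_add.trans hW))) (lt_irrefl _)
  have hm : m ≠ ∞ := (hmr.trans_le le_top).ne
  have h0 : r - m ≠ 0 := (tsub_pos_of_lt hmr).ne'
  have hr0 : r ≠ 0 := (bot_le.trans_lt hmr).ne'
  rw [ENNReal.div_le_iff h0 (ENNReal.sub_ne_top hr), ← ENNReal.mul_div_right_comm,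
    ENNReal.le_div_iff_mul_le (Or.inl hr0) (Or.inl hr)]
  lift A to NNReal using hAt
  lift L to NNReal using hL
  lift W to NNReal using hWt
  lift m to NNReal using hm
  lift r to NNReal using hr
  norm_cast at *
  have h1 : ((r - m : NNReal) : ℝ) = r - m := NNReal.coe_sub hmr.le
  rw [← NNReal.coe_le_coe] at hW ⊢
  rw [← NNReal.coe_lt_coe] at hWr hmr
  push_cast at *
  rw [h1]
  nlinarith [mul_le_mul_of_nonneg_left hW (sub_nonneg.2 hmr.le), m.2, A.2,
    mul_nonneg m.2 (sub_nonneg.2 hWr.le), mul_le_mul_of_nonneg_left hW m.2,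
    mul_le_mul_of_nonneg_left hW r.2]

open Classical in
/-- Selection in a forest with parent map `p`, node weights `m` and level costs `L`, where `W` bounds
the total weighted cost of the subtree below a node. The first nodes `Q` on each branch satisfying
`R(Q) * L(Q) ≤ W(Q)` have small total cost and meet every branch of total weight larger than `t`. -/
theorem exists_tree_selection {κ : Type*} (p : κ → κ) (m W : ℕ → κ → ℝ≥0∞) (L : ℕ → ℝ≥0∞)
    (hW : ∀ j k, m j k * L j + ∑' k' : p ⁻¹' {k}, W (j + 1) k' ≤ W j k)
    (hL0 : ∀ j, L j ≠ 0) (hL : ∀ j, L j ≠ ∞) {t : ℝ≥0∞} (ht0 : t ≠ 0) (ht : t ≠ ∞) :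
    ∃ T : ℕ → Set κ, ∑' j, ∑' _ : T j, L j ≤ (∑' k, W 0 k) / t ∧
      ∀ a : ℕ → κ, (∀ j, p (a (j + 1)) = a j) →
        t < ∑' i, m i (a i) → ∃ j, a j ∈ T j := by
  set R := residualThreshold p m t with hR
  set act := IsActiveNode p L W R with hact
  have hRt : ∀ j k, R j k ≠ ∞ := fun j k => ne_top_of_le_ne_top ht (residualThreshold_le p m t j k)
  -- If `R ≤ m` at the parent, then `R L ≤ m L ≤ W` and the branch stops there.
  have hR0 : ∀ j k, act j k → R j k ≠ 0 := by
    intro j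
    cases j with
    | zero => exact fun _ _ => ht0
    | succ j =>
      refine fun k hk => (tsub_pos_of_lt (not_le.1 fun h => hk.2.not_ge ?_)).ne'
      exact (mul_le_mul_left h _).trans (le_self_add.trans (hW j (p k)))
  refine ⟨fun j => {k | act j k ∧ R j k * L j ≤ W j k}, ?_, ?_⟩
  · set T : ℕ → Set κ := fun j => {k | act j k ∧ R j k * L j ≤ W j k} with hT
    -- The cost already paid plus the potential `∑ W / R` over active nodes does not increase with
    -- `J`: a selected node pays `L ≤ W / R`, any other active node passes its potential on.
    have key : ∀ J, ∑ i ∈ Finset.range J, ∑' _ : T i, L i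
        + ∑' k, (if act J k then W J k / R J k else 0) ≤ (∑' k, W 0 k) / t := by
      intro J
      induction J with
      | zero =>
        have h : ∀ k, act 0 k := fun k => trivial
        simp only [Finset.range_zero, Finset.sum_empty, zero_add, h, if_true]
        simp only [hR, residualThreshold, div_eq_mul_inv, ENNReal.tsum_mul_right, le_refl]
      | succ J ih =>
        refine le_trans ?_ ih
        rw [Finset.sum_range_succ, add_assoc]
        gcongr
        rw [tsum_subtype (T J) (fun _ => L J), ← ENNReal.tsum_fiberwise
            (fun k => if act (J + 1) k then W (J + 1) k / R (J + 1) k else 0) p,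
          ← ENNReal.tsum_add]
        refine ENNReal.tsum_le_tsum fun k => ?_
        by_cases hk : act J k
        · rw [if_pos hk]
          by_cases hs : R J k * L J ≤ W J k
          · rw [indicator_of_mem (show k ∈ T J from ⟨hk, hs⟩)]
            have : ∀ k' : p ⁻¹' {k}, (if act (J + 1) k' then W (J + 1) k' / R (J + 1) k' else 0)
                = 0 := by
              rintro ⟨k', rfl⟩
              exact if_neg fun h => h.2.not_ge hs
            simp only [this, tsum_zero, add_zero]
            rw [ENNReal.le_div_iff_mul_le (Or.inl (hR0 J k hk)) (Or.inl (hRt J k)), mul_comm]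
            exact hs
          · rw [indicator_of_notMem (show k ∉ T J from fun h => hs h.2), zero_add]
            refine le_trans ?_ (ENNReal.div_tsub_le_div (hL0 J) (hL J) (hRt J k) (hW J k)
              (not_le.1 hs))
            rw [div_eq_mul_inv, ← ENNReal.tsum_mul_right]
            refine ENNReal.tsum_le_tsum ?_
            rintro ⟨k', rfl⟩
            dsimp only
            split_ifs
            · exact le_rfl
            · exact bot_le
        · rw [if_neg hk, indicator_of_notMem (show k ∉ T J from fun h => hk h.1), zero_add]
          refine le_of_eq (ENNReal.tsum_eq_zero.2 ?_)
          rintro ⟨k', rfl⟩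
          exact if_neg fun h => hk h.1
    rw [ENNReal.tsum_eq_iSup_nat]
    exact iSup_le fun J => le_self_add.trans (key J)
  · intro a ha hta
    rw [ENNReal.tsum_eq_iSup_nat, lt_iSup_iff] at hta
    obtain ⟨J, hJ⟩ := hta
    by_contra! hno
    have hactive : ∀ j, act j (a j) := by
      intro j
      induction j with
      | zero => trivial
      | succ j ih =>
        refine ⟨by rwa [ha], ?_⟩
        rw [ha]
        by_contra! h
        exact hno j ⟨ih, h⟩
    have hlt : ∀ j, ¬ R j (a j) ≤ m j (a j) := fun j h =>
      hno j ⟨hactive j, (mul_le_mul_left h _).trans (le_self_add.trans (hW j (a j)))⟩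
    -- The partial sum up to `J` exceeds `t`, so the truncated residual at `J` is zero.
    refine hlt J ?_
    rw [hR, residualThreshold_branch p m t a ha, tsub_le_iff_left]
    exact hJ.le.trans le_self_add

open Classical in
/-- The tree selection for weights given by a family of weighted nodes `(l x, v x)`. -/
theorem exists_tree_selection_of_family {κ β : Type*} (p : κ → κ) (l : β → ℕ) (v : β → κ)
    (c : β → ℝ≥0∞) (L : ℕ → ℝ≥0∞)
    (hL0 : ∀ j, L j ≠ 0) (hL : ∀ j, L j ≠ ∞) {t : ℝ≥0∞} (ht0 : t ≠ 0) (ht : t ≠ ∞) :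
    ∃ T : ℕ → Set κ, ∑' j, ∑' _ : T j, L j ≤ (∑' x, c x * L (l x)) / t ∧
      ∀ a : ℕ → κ, (∀ j, p (a (j + 1)) = a j) →
        t < ∑' x, (if v x = a (l x) then c x else 0) → ∃ j, a j ∈ T j := by
  -- Here `W j k` is the total cost of the family members at or below `k`; the guard `j ≤ l x`
  -- excludes truncated subtraction.
  have hW : ∀ j k, (∑' x, if l x = j ∧ v x = k then c x else 0) * L j + ∑' k' : p ⁻¹' {k},
      (∑' x, if j + 1 ≤ l x ∧ p^[l x - (j + 1)] (v x) = k' then c x * L (l x) else 0) ≤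
      ∑' x, if j ≤ l x ∧ p^[l x - j] (v x) = k then c x * L (l x) else 0 := by
    intro j k
    rw [ENNReal.tsum_comm, ← ENNReal.tsum_mul_right, ← ENNReal.tsum_add]
    refine ENNReal.tsum_le_tsum fun x => ?_
    rcases lt_trichotomy (l x) j with h | h | h
    · simp [h.ne, show ¬ j + 1 ≤ l x by omega]
    · simp [h]
    · obtain ⟨i, hi⟩ : ∃ i, l x = j + 1 + i := ⟨l x - (j + 1), by omega⟩
      have h1 : l x - j = i + 1 := by omega
      have h2 : l x - (j + 1) = i := by omega
      simp only [h.ne', false_and, if_false, zero_mul, zero_add, h1, h2, h.le, true_and,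
        show j + 1 ≤ l x by omega, Function.iterate_succ', Function.comp]
      by_cases hk : p (p^[i] (v x)) = k
      · rw [if_pos hk, tsum_eq_single (⟨p^[i] (v x), hk⟩ : p ⁻¹' {k})]
        · simp
        · rintro ⟨b, hb⟩ hne
          exact if_neg fun h => hne (Subtype.ext h.symm)
      · rw [if_neg hk]
        refine le_of_eq (ENNReal.tsum_eq_zero.2 ?_)
        rintro ⟨b, hb⟩
        exact if_neg fun h => hk (by rw [h]; exact hb)
  obtain ⟨T, hT, hcov⟩ := exists_tree_selection p
    (fun j k => ∑' x, if l x = j ∧ v x = k then c x else 0)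
    (fun j k => ∑' x, if j ≤ l x ∧ p^[l x - j] (v x) = k then c x * L (l x) else 0)
    L hW hL0 hL ht0 ht
  refine ⟨T, ?_, fun a ha hta => hcov a ha ?_⟩
  · rw [ENNReal.tsum_comm (α := κ)] at hT
    simpa [ENNReal.tsum_comm (α := κ), tsum_ite_eq] using hT
  · rw [ENNReal.tsum_comm]
    refine hta.trans_le (ENNReal.tsum_le_tsum fun x => ?_)
    refine le_trans ?_ (ENNReal.le_tsum (l x))
    simp

/-! ### Hausdorff content -/

/-- A set of vanishing `s`-dimensional Hausdorff content is null for the Hausdorff measure. -/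
theorem hausdorffMeasure_eq_zero_of_covers {X ι : Type*} [EMetricSpace X] [MeasurableSpace X]
    [BorelSpace X] [Countable ι] {s : ℝ} (hs : 0 < s) {A : Set X}
    (h : ∀ ε : ℝ≥0∞, ε ≠ 0 → ∃ C : ι → Set X, A ⊆ ⋃ i, C i ∧ ∑' i, Metric.ediam (C i) ^ s ≤ ε) :
    Measure.hausdorffMeasure s A = 0 := by
  have hpos : ∀ n : ℕ, ((n : ℝ≥0∞))⁻¹ ≠ 0 := fun n => by simp
  choose C hC hsum using fun n : ℕ => h _ (hpos n)
  have htend := ENNReal.tendsto_inv_nat_nhds_zero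
  refine le_antisymm ?_ bot_le
  refine (Measure.hausdorffMeasure_le_liminf_tsum (l := atTop) s A
    (fun n : ℕ => ((n : ℝ≥0∞)⁻¹) ^ s⁻¹) ?_ C ?_ (Eventually.of_forall hC)).trans ?_
  · have := (ENNReal.continuous_rpow_const (y := s⁻¹)).tendsto 0
    rw [ENNReal.zero_rpow_of_pos (inv_pos.2 hs)] at this
    exact this.comp htend
  -- A small sum bounds each diameter, so the mesh tends to zero by itself.
  · refine Eventually.of_forall fun n i => ?_
    rw [ENNReal.le_rpow_inv_iff hs]
    exact (ENNReal.le_tsum i).trans (hsum n)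
  · rw [← htend.liminf_eq]
    exact liminf_le_liminf (Eventually.of_forall hsum)

/-! ### Dyadic cubes and the Chebyshev inequality for content -/

/-- The multi-index of the dyadic cube of side length `M / 2 ^ j` which contains `y`. -/
noncomputable def dyadicIndex {d : ℕ} (M : ℝ) (j : ℕ) (y : EuclideanSpace ℝ (Fin d)) :
    Fin d → ℤ :=
  fun i => ⌊y i / M * 2 ^ j⌋

theorem dyadicIndex_succ_div_two {d : ℕ} (M : ℝ) (j : ℕ) (y : EuclideanSpace ℝ (Fin d)) :
    (fun i => dyadicIndex M (j + 1) y i / 2) = dyadicIndex M j y := by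
  ext i
  have h := Int.floor_div_natCast (y i / M * 2 ^ (j + 1)) 2
  simp only [dyadicIndex]
  rw [show ((2 : ℕ) : ℤ) = 2 from rfl] at h
  rw [← h]
  congr 1
  push_cast
  ring

theorem ediam_dyadicIndex_fiber_le {d : ℕ} {M : ℝ} (hM : 0 < M) (j : ℕ) (k : Fin d → ℤ) :
    Metric.ediam {y : EuclideanSpace ℝ (Fin d) | dyadicIndex M j y = k} ≤
      ENNReal.ofReal (√d) * ENNReal.ofReal (M / 2 ^ j) := by
  refine Metric.ediam_le fun x hx y hy => ?_
  have hs : 0 < M / 2 ^ j := by positivity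
  rw [← ENNReal.ofReal_mul (Real.sqrt_nonneg _), edist_dist]
  refine ENNReal.ofReal_le_ofReal ?_
  rw [EuclideanSpace.dist_eq, ← Real.sqrt_sq hs.le, ← Real.sqrt_mul (Nat.cast_nonneg _)]
  refine Real.sqrt_le_sqrt ?_
  have : ∀ i ∈ Finset.univ, dist (x i) (y i) ^ 2 ≤ (M / 2 ^ j) ^ 2 := by
    intro i _
    have hxy : ⌊x i / M * 2 ^ j⌋ = ⌊y i / M * 2 ^ j⌋ := congrFun (hx.trans hy.symm) i
    have h := Int.abs_sub_lt_one_of_floor_eq_floor hxy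
    have e : x i / M * 2 ^ j - y i / M * 2 ^ j = (x i - y i) / (M / 2 ^ j) := by
      field_simp
    rw [e, abs_div, abs_of_pos hs, div_lt_one hs] at h
    rw [Real.dist_eq]
    gcongr
  simpa using Finset.sum_le_sum this

/-- A nondegenerate set meets at most `3 ^ d` dyadic cubes of a suitable size comparable to its
diameter. -/
theorem exists_dyadic_level {d : ℕ} {M : ℝ} (hM : 0 < M) {F : Set (EuclideanSpace ℝ (Fin d))}
    (hF : Metric.ediam F ≠ 0) (hFM : Metric.ediam F ≤ ENNReal.ofReal M) :
    ∃ (j : ℕ) (N : Finset (Fin d → ℤ)), N.card ≤ 3 ^ d ∧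
      ENNReal.ofReal (M / 2 ^ j) ≤ 2 * Metric.ediam F ∧ ∀ y ∈ F, dyadicIndex M j y ∈ N := by
  have htop : Metric.ediam F ≠ ∞ := ne_top_of_le_ne_top ENNReal.ofReal_ne_top hFM
  set δ := (Metric.ediam F).toReal with hδ
  have hFδ : Metric.ediam F = ENNReal.ofReal δ := (ENNReal.ofReal_toReal htop).symm
  have hδ0 : 0 < δ := ENNReal.toReal_pos hF htop
  have hδM : δ ≤ M := by
    rw [hFδ] at hFM
    exact (ENNReal.ofReal_le_ofReal_iff hM.le).1 hFM
  -- `M / 2 ^ (j + 1) < δ ≤ M / 2 ^ j`: the side is below `2 δ`, and each index coordinate varies by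
  -- at most one from that of `x`.
  obtain ⟨j, hj1, hj2⟩ := exists_nat_pow_near_of_lt_one (div_pos hδ0 hM)
    ((div_le_one hM).2 hδM) (by norm_num : (0 : ℝ) < 1 / 2) (by norm_num)
  rw [one_div, inv_pow, ← one_div, div_lt_div_iff₀ (by positivity) hM] at hj1
  rw [one_div, inv_pow, ← one_div, div_le_div_iff₀ hM (by positivity)] at hj2
  obtain ⟨x, hx⟩ : F.Nonempty := by
    rw [nonempty_iff_ne_empty]
    rintro rfl
    exact hF Metric.ediam_empty
  refine ⟨j, Fintype.piFinset fun i => Finset.Icc (dyadicIndex M j x i - 1)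
    (dyadicIndex M j x i + 1), ?_, ?_, ?_⟩
  · rw [Fintype.card_piFinset]
    simp only [Int.card_Icc]
    rw [Finset.prod_congr rfl (g := fun _ => 3) (fun i _ => by omega)]
    simp
  · rw [hFδ, ← ENNReal.ofReal_ofNat, ← ENNReal.ofReal_mul (by norm_num)]
    refine ENNReal.ofReal_le_ofReal ?_
    rw [div_le_iff₀ (by positivity)]
    rw [pow_succ] at hj1
    linarith
  · intro y hy
    rw [Fintype.mem_piFinset]
    intro i
    have hdist : dist y x ≤ δ := by
      have := Metric.edist_le_ediam_of_mem hy hx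
      rw [hFδ, edist_dist] at this
      exact (ENNReal.ofReal_le_ofReal_iff hδ0.le).1 this
    have hi : |y i - x i| ≤ δ := by
      have := PiLp.norm_apply_le (y - x) i
      rw [← dist_eq_norm, Real.norm_eq_abs] at this
      exact this.trans hdist
    have hi' : |y i / M * 2 ^ j - x i / M * 2 ^ j| ≤ 1 := by
      rw [show y i / M * 2 ^ j - x i / M * 2 ^ j = (y i - x i) * (2 ^ j / M) by ring, abs_mul,
        abs_of_pos (show (0 : ℝ) < 2 ^ j / M by positivity), ← mul_div_assoc, div_le_one hM]
      calc |y i - x i| * 2 ^ j ≤ δ * 2 ^ j := by gcongr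
        _ ≤ M := by linarith
    rw [abs_le] at hi'
    rw [Finset.mem_Icc]
    simp only [dyadicIndex]
    constructor
    · rw [← Int.floor_sub_one]
      exact Int.floor_le_floor (by linarith)
    · rw [← Int.floor_add_one]
      exact Int.floor_le_floor (by linarith)

/-- A covering estimate for superlevel sets of a weighted sum of indicator functions: their
`q`-dimensional Hausdorff content satisfies a Chebyshev inequality. -/
theorem exists_cover_superlevel {d : ℕ} {q M : ℝ} (hq : 0 < q) (hM : 0 < M) {ι : Type*}
    (c : ι → ℝ≥0∞) (F : ι → Set (EuclideanSpace ℝ (Fin d))) (hF : ∀ a, Metric.ediam (F a) ≠ 0)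
    (hFM : ∀ a, Metric.ediam (F a) ≤ ENNReal.ofReal M) {t : ℝ≥0∞} (ht0 : t ≠ 0) (ht : t ≠ ∞) :
    ∃ C : ℕ × (Fin d → ℤ) → Set (EuclideanSpace ℝ (Fin d)),
      {y | t < ∑' a, (F a).indicator (fun _ => c a) y} ⊆ ⋃ x, C x ∧
      ∑' x, Metric.ediam (C x) ^ q ≤
        ENNReal.ofReal (√d) ^ q * (3 ^ d * 2 ^ q * (∑' a, c a * Metric.ediam (F a) ^ q) / t) := by
  classical
  choose lev N hN hlev hmem using fun a => exists_dyadic_level hM (hF a) (hFM a)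
  set L : ℕ → ℝ≥0∞ := fun j => ENNReal.ofReal (M / 2 ^ j) ^ q with hLdef
  have hs : ∀ j : ℕ, 0 < M / 2 ^ j := fun j => by positivity
  -- Each of the at most `3 ^ d` cubes replacing `F a` carries the full weight `c a`, so the sum at
  -- a point does not drop.
  obtain ⟨T, hT, hcov⟩ := exists_tree_selection_of_family (fun (k : Fin d → ℤ) i => k i / 2)
    (fun x : (a : ι) × N a => lev x.1) (fun x => (x.2 : Fin d → ℤ)) (fun x => c x.1) L
    (fun j => (ENNReal.rpow_pos (ENNReal.ofReal_pos.2 (hs j)) ENNReal.ofReal_ne_top).ne')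
    (fun j => ENNReal.rpow_ne_top_of_nonneg hq.le ENNReal.ofReal_ne_top) ht0 ht
  refine ⟨fun x => {y | dyadicIndex M x.1 y = x.2 ∧ x.2 ∈ T x.1}, ?_, ?_⟩
  · intro y hy
    have hyt : t < ∑' x : (a : ι) × N a,
        if (x.2 : Fin d → ℤ) = dyadicIndex M (lev x.1) y then c x.1 else 0 := by
      refine lt_of_lt_of_le hy ?_
      rw [ENNReal.tsum_sigma']
      refine ENNReal.tsum_le_tsum fun a => ?_
      by_cases hya : y ∈ F a
      · rw [indicator_of_mem hya]
        refine le_trans ?_ (ENNReal.le_tsum ⟨_, hmem a y hya⟩)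
        simp
      · rw [indicator_of_notMem hya]
        exact bot_le
    obtain ⟨j, hj⟩ := hcov (fun j => dyadicIndex M j y)
      (fun j => dyadicIndex_succ_div_two M j y) (by convert hyt)
    exact mem_iUnion.2 ⟨(j, dyadicIndex M j y), rfl, hj⟩
  · have h1 : ∑' x : ℕ × (Fin d → ℤ),
        Metric.ediam {y : EuclideanSpace ℝ (Fin d) | dyadicIndex M x.1 y = x.2 ∧ x.2 ∈ T x.1} ^ q
        ≤ ENNReal.ofReal (√d) ^ q * ∑' j, ∑' _ : T j, L j := by
      rw [ENNReal.tsum_prod', ← ENNReal.tsum_mul_left]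
      refine ENNReal.tsum_le_tsum fun j => ?_
      rw [← ENNReal.tsum_mul_left, tsum_subtype (T j) (fun _ => ENNReal.ofReal (√d) ^ q * L j)]
      refine ENNReal.tsum_le_tsum fun k => ?_
      by_cases hk : k ∈ T j
      · simp only [hk, and_true, indicator_of_mem, hLdef]
        rw [← ENNReal.mul_rpow_of_nonneg _ _ hq.le]
        exact ENNReal.rpow_le_rpow (ediam_dyadicIndex_fiber_le hM j k) hq.le
      · simp [hk, hq]
    refine h1.trans ?_
    gcongr
    refine hT.trans ?_
    gcongr
    rw [ENNReal.tsum_sigma', ← ENNReal.tsum_mul_left]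
    refine ENNReal.tsum_le_tsum fun a => ?_
    dsimp only
    rw [tsum_fintype, Finset.sum_const, nsmul_eq_mul, Finset.card_univ, Fintype.card_coe]
    have h2 : L (lev a) ≤ 2 ^ q * Metric.ediam (F a) ^ q := by
      rw [← ENNReal.mul_rpow_of_nonneg _ _ hq.le]
      exact ENNReal.rpow_le_rpow (hlev a) hq.le
    have h3 : ((N a).card : ℝ≥0∞) ≤ 3 ^ d := by exact_mod_cast hN a
    calc ((N a).card : ℝ≥0∞) * (c a * L (lev a))
        ≤ 3 ^ d * (c a * (2 ^ q * Metric.ediam (F a) ^ q)) := by gcongr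
      _ = _ := by ring

/-! ### Subadditivity and null fibres -/

/-- Covers indexed by an arbitrary countable type may be used to bound `coverPhi`. -/
theorem coverPhi_le_tsum {n d : ℕ} {μ q : ℝ} (hμ : 0 < μ)
    (f : EuclideanSpace ℝ (Fin n) → EuclideanSpace ℝ (Fin d)) {β : Type*} [Countable β]
    {E : Set (EuclideanSpace ℝ (Fin n))} (D : β → Set (EuclideanSpace ℝ (Fin n)))
    (hD : ∀ b, IsCompact (D b)) (hE : E ⊆ ⋃ b, D b) :
    coverPhi μ q f E ≤ ∑' b, Metric.ediam (D b) ^ μ * Metric.ediam (f '' D b) ^ q := by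
  obtain ⟨e, he⟩ := exists_injective_nat β
  refine (iInf₂_le_of_le (Function.extend e D fun _ => ∅) ?_ (iInf_le_of_le ?_ le_rfl)).trans ?_
  · intro i
    by_cases hi : ∃ b, e b = i
    · obtain ⟨b, rfl⟩ := hi
      rw [he.extend_apply]
      exact hD b
    · rw [Function.extend_apply' _ _ _ hi]
      exact isCompact_empty
  · refine hE.trans (iUnion_subset fun b => ?_)
    have := subset_iUnion (Function.extend e D fun _ => ∅) (e b)
    rwa [he.extend_apply] at this
  · rw [← he.tsum_eq]
    · simp only [he.extend_apply, le_refl]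
    · intro i hi
      by_contra h
      refine hi ?_
      dsimp only
      rw [Function.extend_apply' _ _ _ h, Metric.ediam_empty, ENNReal.zero_rpow_of_pos hμ, zero_mul]

theorem exists_cover_of_coverPhi_lt {n d : ℕ} {μ q : ℝ}
    {f : EuclideanSpace ℝ (Fin n) → EuclideanSpace ℝ (Fin d)}
    {E : Set (EuclideanSpace ℝ (Fin n))} {b : ℝ≥0∞} (h : coverPhi μ q f E < b) :
    ∃ D : ℕ → Set (EuclideanSpace ℝ (Fin n)), (∀ α, IsCompact (D α)) ∧ E ⊆ ⋃ α, D α ∧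
      ∑' α, Metric.ediam (D α) ^ μ * Metric.ediam (f '' D α) ^ q < b := by
  simpa only [coverPhi, iInf_lt_iff, exists_prop] using h

theorem coverPhi_le_tsum_coverPhi {n d : ℕ} {μ q : ℝ} (hμ : 0 < μ)
    (f : EuclideanSpace ℝ (Fin n) → EuclideanSpace ℝ (Fin d)) {ι : Type*} [Countable ι]
    {E : Set (EuclideanSpace ℝ (Fin n))} {S : ι → Set (EuclideanSpace ℝ (Fin n))}
    (hE : E ⊆ ⋃ i, S i) : coverPhi μ q f E ≤ ∑' i, coverPhi μ q f (S i) := by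
  refine ENNReal.le_of_forall_pos_le_add fun ε hε hfin => ?_
  obtain ⟨δ, hδ0, hδ⟩ := ENNReal.exists_pos_sum_of_countable
    (ENNReal.coe_ne_zero.2 hε.ne') ι
  have hne : ∀ i, coverPhi μ q f (S i) ≠ ∞ := fun i =>
    ne_top_of_le_ne_top hfin.ne (ENNReal.le_tsum i)
  choose D hDc hDS hD using fun i => exists_cover_of_coverPhi_lt
    (ENNReal.lt_add_right (hne i) (ENNReal.coe_ne_zero.2 (hδ0 i).ne'))
  refine (coverPhi_le_tsum hμ f (fun x : ι × ℕ => D x.1 x.2) (fun x => hDc _ _) ?_).trans ?_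
  · intro y hy
    obtain ⟨i, hi⟩ := mem_iUnion.1 (hE hy)
    obtain ⟨α, hα⟩ := mem_iUnion.1 (hDS i hi)
    exact mem_iUnion.2 ⟨(i, α), hα⟩
  · rw [ENNReal.tsum_prod']
    refine (ENNReal.tsum_le_tsum fun i => (hD i).le).trans ?_
    rw [ENNReal.tsum_add]
    gcongr

theorem ae_hausdorffMeasure_fiber_eq_zero_of_subset_closedBall {n d : ℕ} {μ q : ℝ}
    (hμ : 0 < μ) (hq : 0 < q)
    {f : EuclideanSpace ℝ (Fin n) → EuclideanSpace ℝ (Fin d)} (hf : Continuous f)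
    {E : Set (EuclideanSpace ℝ (Fin n))} {r : ℝ} (hEr : E ⊆ Metric.closedBall 0 r)
    (hE : coverPhi μ q f E = 0) :
    ∀ᵐ y ∂(Measure.hausdorffMeasure q : Measure (EuclideanSpace ℝ (Fin d))),
      (Measure.hausdorffMeasure μ : Measure (EuclideanSpace ℝ (Fin n))) (E ∩ f ⁻¹' {y}) = 0 := by
  obtain ⟨M, hM, hfM⟩ : ∃ M : ℝ, 0 < M ∧
      Metric.ediam (f '' Metric.closedBall 0 r) ≤ ENNReal.ofReal M := by
    have hb : Metric.ediam (f '' Metric.closedBall 0 r) ≠ ∞ :=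
      ((isCompact_closedBall 0 r).image hf).isBounded.ediam_ne_top
    refine ⟨(Metric.ediam (f '' Metric.closedBall 0 r)).toReal + 1, by positivity, ?_⟩
    rw [ENNReal.le_ofReal_iff_toReal_le hb (by positivity)]
    linarith
  have hcov : ∀ m : ℕ, ∃ D : ℕ → Set (EuclideanSpace ℝ (Fin n)), E ⊆ ⋃ α, D α ∧
      (∀ α, D α ⊆ Metric.closedBall 0 r) ∧
      ∑' α, Metric.ediam (D α) ^ μ * Metric.ediam (f '' D α) ^ q ≤ (m : ℝ≥0∞)⁻¹ := by
    intro m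
    obtain ⟨D, -, hED, hD⟩ := exists_cover_of_coverPhi_lt
      (show coverPhi μ q f E < (m : ℝ≥0∞)⁻¹ by rw [hE]; simp)
    -- Cutting to the ball bounds all image diameters by `M`, the side of the level-zero cubes.
    refine ⟨fun α => D α ∩ Metric.closedBall 0 r, ?_, fun α => inter_subset_right, ?_⟩
    · rw [← iUnion_inter]
      exact subset_inter hED hEr
    · refine le_trans (ENNReal.tsum_le_tsum fun α => ?_) hD.le
      have h := inter_subset_left (s := D α) (t := Metric.closedBall 0 r)
      exact mul_le_mul' (ENNReal.rpow_le_rpow (Metric.ediam_mono h) hμ.le)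
        (ENNReal.rpow_le_rpow (Metric.ediam_mono (image_mono h)) hq.le)
  choose D hED hDr hD using hcov
  set I : ℕ → Set ℕ := fun m => {α | Metric.ediam (f '' D m α) ≠ 0} with hI
  set g : ℕ → EuclideanSpace ℝ (Fin d) → ℝ≥0∞ := fun m y =>
    ∑' α : I m, (f '' D m α).indicator (fun _ => Metric.ediam (D m α) ^ μ) y with hg
  -- Images of zero diameter have no dyadic level; being subsingletons, they are jointly null since
  -- `q > 0`.
  have hdeg : ∀ᵐ y ∂(Measure.hausdorffMeasure q : Measure (EuclideanSpace ℝ (Fin d))),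
      ∀ m α, α ∉ I m → y ∉ f '' D m α := by
    have := Measure.nullSingletonClass_hausdorff (EuclideanSpace ℝ (Fin d)) hq
    rw [ae_all_iff]
    refine fun m => ae_all_iff.2 fun α => ?_
    by_cases hα : α ∈ I m
    · exact Eventually.of_forall fun y h => absurd hα h
    · have h0 : Metric.ediam (f '' D m α) = 0 := not_not.1 hα
      have := measure_eq_zero_iff_ae_notMem.1 ((Metric.ediam_eq_zero_iff.1 h0).measure_zero
        (Measure.hausdorffMeasure q))
      filter_upwards [this] with y hy _ using hy
  have hsmall : ∀ᵐ y ∂(Measure.hausdorffMeasure q : Measure (EuclideanSpace ℝ (Fin d))),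
      ∀ k : ℕ, ∃ m, g m y ≤ ((k : ℝ≥0∞) + 1)⁻¹ := by
    rw [ae_all_iff]
    intro k
    have ht0 : ((k : ℝ≥0∞) + 1)⁻¹ ≠ 0 := by simp
    have ht : ((k : ℝ≥0∞) + 1)⁻¹ ≠ ∞ := by simp
    rw [ae_iff]
    push Not
    refine hausdorffMeasure_eq_zero_of_covers (ι := ℕ × (Fin d → ℤ)) hq fun ε hε => ?_
    set K : ℝ≥0∞ := ENNReal.ofReal (√d) ^ q * (3 ^ d * 2 ^ q / ((k : ℝ≥0∞) + 1)⁻¹) with hK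
    have hKt : K ≠ ∞ := by
      refine ENNReal.mul_ne_top (ENNReal.rpow_ne_top_of_nonneg hq.le ENNReal.ofReal_ne_top)
        (ENNReal.div_ne_top (ENNReal.mul_ne_top (by simp)
          (ENNReal.rpow_ne_top_of_nonneg hq.le (by simp))) ht0)
    -- A bad `y` has `g m y > 1 / (k + 1)` for every `m`, so `m` may be chosen after `ε`; `K` does
    -- not depend on `m`.
    obtain ⟨m, hm⟩ : ∃ m : ℕ, K * (m : ℝ≥0∞)⁻¹ < ε := by
      have h := ENNReal.Tendsto.const_mul (a := K) ENNReal.tendsto_inv_nat_nhds_zero (Or.inr hKt)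
      rw [mul_zero] at h
      exact (h.eventually_lt_const (pos_iff_ne_zero.2 hε)).exists
    obtain ⟨C, hC, hCs⟩ := exists_cover_superlevel hq hM
      (fun α : I m => Metric.ediam (D m α) ^ μ) (fun α : I m => f '' D m α) (fun α => α.2)
      (fun α => (Metric.ediam_mono (image_mono (hDr m α))).trans hfM) ht0 ht
    refine ⟨C, fun y hy => hC (hy m), hCs.trans (le_trans ?_ hm.le)⟩
    have h1 : ∑' α : I m, Metric.ediam (D m α) ^ μ * Metric.ediam (f '' D m α) ^ q
        ≤ (m : ℝ≥0∞)⁻¹ :=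
      (ENNReal.tsum_comp_le_tsum_of_injective Subtype.val_injective
        (fun α => Metric.ediam (D m α) ^ μ * Metric.ediam (f '' D m α) ^ q)).trans (hD m)
    rw [hK, ENNReal.mul_div_right_comm, mul_assoc]
    gcongr
  filter_upwards [hdeg, hsmall] with y hy1 hy2
  refine hausdorffMeasure_eq_zero_of_covers (ι := ℕ) hμ fun ε hε => ?_
  obtain ⟨k, hk⟩ := ENNReal.exists_inv_nat_lt hε
  obtain ⟨m, hm⟩ := hy2 k
  -- Each piece is `D m α` if `y` lies in its image and empty otherwise, so the sum is at most `g m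
  -- y`.
  refine ⟨fun α => {x ∈ D m α | y ∈ f '' D m α}, ?_, ?_⟩
  · rintro x ⟨hx, hxy⟩
    obtain ⟨α, hα⟩ := mem_iUnion.1 (hED m hx)
    exact mem_iUnion.2 ⟨α, hα, x, hα, hxy⟩
  · have hle : ((k : ℝ≥0∞) + 1)⁻¹ ≤ ε := (ENNReal.inv_le_inv.2 le_self_add).trans hk.le
    refine le_trans ?_ (hm.trans hle)
    rw [hg]
    dsimp only
    rw [tsum_subtype (I m)
      (fun α => (f '' D m α).indicator (fun _ => Metric.ediam (D m α) ^ μ) y)]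
    refine ENNReal.tsum_le_tsum fun α => ?_
    by_cases hα : y ∈ f '' D m α
    · have hαI : α ∈ I m := by
        by_contra h
        exact hy1 m α h hα
      rw [indicator_of_mem hαI, indicator_of_mem hα]
      exact ENNReal.rpow_le_rpow (Metric.ediam_mono (sep_subset _ _)) hμ.le
    · simp [hα, hμ]

theorem theorem6p1 {n d : ℕ} {μ q : ℝ} (hμ₀ : 0 < μ) (hμn : μ ≤ (n : ℝ))
    (hq₀ : 0 < q) (hqd : q ≤ (d : ℝ))
    (f : EuclideanSpace ℝ (Fin n) → EuclideanSpace ℝ (Fin d)) (hf : Continuous f) :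
    (∀ (ι : Type) [Countable ι] (E : Set (EuclideanSpace ℝ (Fin n)))
        (S : ι → Set (EuclideanSpace ℝ (Fin n))),
        E ⊆ ⋃ i, S i → coverPhi μ q f E ≤ ∑' i, coverPhi μ q f (S i)) ∧
    (∀ E : Set (EuclideanSpace ℝ (Fin n)), coverPhi μ q f E = 0 →
        ∀ᵐ y ∂(Measure.hausdorffMeasure q : Measure (EuclideanSpace ℝ (Fin d))),
          (Measure.hausdorffMeasure μ : Measure (EuclideanSpace ℝ (Fin n)))
            (E ∩ f ⁻¹' {y}) = 0) := by
  refine ⟨fun ι _ E S hES => coverPhi_le_tsum_coverPhi hμ₀ f hES, fun E hE => ?_⟩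
  have hball : ∀ r : ℕ, ∀ᵐ y ∂(Measure.hausdorffMeasure q : Measure (EuclideanSpace ℝ (Fin d))),
      (Measure.hausdorffMeasure μ : Measure (EuclideanSpace ℝ (Fin n)))
        ((E ∩ Metric.closedBall 0 (r : ℝ)) ∩ f ⁻¹' {y}) = 0 := by
    intro r
    refine ae_hausdorffMeasure_fiber_eq_zero_of_subset_closedBall hμ₀ hq₀ hf
      inter_subset_right (le_antisymm ?_ bot_le)
    refine (coverPhi_le_tsum_coverPhi hμ₀ f (ι := Unit) (S := fun _ => E)
      (fun x hx => mem_iUnion.2 ⟨(), hx.1⟩)).trans ?_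
    simp [hE]
  filter_upwards [ae_all_iff.2 hball] with y hy
  refine measure_mono_null ?_ (measure_iUnion_null hy)
  rintro x ⟨hx, hxy⟩
  obtain ⟨r, hr⟩ := exists_nat_ge ‖x‖
  exact mem_iUnion.2 ⟨r, ⟨hx, mem_closedBall_zero_iff.2 hr⟩, hxy⟩
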